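/- Let $\mathcal K$ be a differential field of characteristic $0$ with field of constants $\mathbb F$, let $Q\in\mathrm{Mat}_{2\times2}\mathcal K$, let $\widetilde{\mathcal K}\supseteq\mathcal K$ be a differential field extension with field of constants $\widetilde{\mathbb F}$, and let $B\in\mathrm{Mat}_{2\times2}\widetilde{\mathcal K}$ be any invertible matrix with $B'+QB=0$. Pseudodifferential operators over $\widetilde{\mathcal K}$ are the formal sums $\sum_{n\le N}a_n\partial^n$ ($N\in\mathbb Z$, $a_n\in\widetilde{\mathcal K}$), multiplied according to $\partial^m\circ f=\sum_{k\ge0}\binom mk f^{(k)}\partial^{m-k}$; they form $\widetilde{\mathcal K}((\partial^{-1}))$. (a) A matrix $R\in\mathrm{Mat}_{2\times2}\widetilde{\mathcal K}((\partial^{-1}))$ satisfies $R^2=\partial\mathbb 1_2+Q$ if and only if $R=B\,\Delta(\partial)\,B^{-1}$ for some matrix with constant coefficients $\Delta\in\mathrm{Mat}_{2\times2}\widetilde{\mathbb F}((\partial^{-1}))$ such that $\mathrm{tr}\,\Delta=0$ and $\det\Delta=-\partial$. (b) These matrices $\Delta$ are exactly the square roots of $\partial\mathbb 1_2$ in $\mathrm{Mat}_{2\times2}\widetilde{\mathcal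 K}((\partial^{-1}))$. (c) They are exactly the matrices $$\Delta=\begin{pmatrix}\alpha(\partial)&\beta(\partial)\\ \beta(\partial)^{-1}(\partial-\alpha(\partial)^2)&-\alpha(\partial)\end{pmatrix},\qquad \alpha,\beta\in\widetilde{\mathbb F}((\partial^{-1})),\ \beta\ne0.$$ (d) If every constant of $\widetilde{\mathcal K}$ lies in $\mathcal K$ (so that $\widetilde{\mathbb F}=\mathbb F$), then (a) holds with $\Delta\in\mathrm{Mat}_{2\times2}\mathbb F((\partial^{-1}))$. -/

import Mathlib

open scoped Differential

noncomputable section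

/-- The subfield of constants of a differential field: the elements with zero derivative. -/
def constantSubfield (K : Type*) [Field K] [Differential K] : Subfield K where
  carrier := {x | x′ = 0}
  zero_mem' := by simp
  one_mem' := by simp
  add_mem' := by
    intro a b ha hb
    simp only [Set.mem_ofPred_eq] at ha hb ⊢
    simp [ha, hb]
  neg_mem' := by
    intro a ha
    simp only [Set.mem_ofPred_eq] at ha ⊢
    simp [ha]
  mul_mem' := by
    intro a b ha hb
    simp only [Set.mem_ofPred_eq] at ha hb ⊢
    simp [Derivation.leibniz, ha, hb]
  inv_mem' := by
    intro a ha
    simp only [Set.mem_ofPred_eq] at ha ⊢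
    simp [Derivation.leibniz_inv, ha]

/-- The group of two-sided sequences `a : ℤ → V` that vanish for all large indices. -/
def boundedAboveSeq (V : Type*) [AddCommGroup V] : AddSubgroup (ℤ → V) where
  carrier := {a | ∃ N : ℤ, ∀ n, N < n → a n = 0}
  zero_mem' := ⟨0, fun _ _ => rfl⟩
  add_mem' := by
    rintro a b ⟨M, hM⟩ ⟨N, hN⟩
    exact ⟨max M N, fun n hn => by
      simp [hM n (lt_of_le_of_lt (le_max_left _ _) hn),
        hN n (lt_of_le_of_lt (le_max_right _ _) hn)]⟩
  neg_mem' := by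
    rintro a ⟨M, hM⟩
    exact ⟨M, fun n hn => by simp [hM n hn]⟩

/-- Scalar pseudodifferential operators `V((∂⁻¹))`: formal sums `∑_{n ≤ N} aₙ ∂ⁿ` with the
coefficients `aₙ ∈ V` written on the left of the powers of `∂`. -/
def PseudoDiffOp (V : Type*) [CommRing V] : Type _ := boundedAboveSeq V

namespace PseudoDiffOp

variable {V : Type*} [CommRing V]

instance : AddCommGroup (PseudoDiffOp V) := inferInstanceAs (AddCommGroup (boundedAboveSeq V))

/-- The coefficient of `∂ⁿ`. -/
def coeff (a : PseudoDiffOp V) (n : ℤ) : V := a.1 n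

theorem coeff_bounded (a : PseudoDiffOp V) : ∃ N : ℤ, ∀ n, N < n → a.coeff n = 0 := a.2

@[ext]
theorem ext {a b : PseudoDiffOp V} (h : ∀ n, a.coeff n = b.coeff n) : a = b :=
  Subtype.ext (funext h)

/-- The operator with the given coefficients. -/
def mk (f : ℤ → V) (hf : ∃ N : ℤ, ∀ n, N < n → f n = 0) : PseudoDiffOp V := ⟨f, hf⟩

/-- The monomial `a ∂ᵐ`. -/
def monomial (m : ℤ) (a : V) : PseudoDiffOp V :=
  mk (fun n => if n = m then a else 0) ⟨m, fun _ hn => if_neg hn.ne'⟩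

/-- Multiplication by a function, `a ∂⁰`. -/
def C (a : V) : PseudoDiffOp V := monomial 0 a

/-- The operator `∂`. -/
def del : PseudoDiffOp V := monomial 1 1

variable [Differential V]

/-- The contribution of `a_m ∂ᵐ` and of the `k`-th term in the expansion
`∂ᵐ ∘ f = ∑_{k ≥ 0} binom(m, k) f⁽ᵏ⁾ ∂^(m - k)` to the coefficient of `∂ʲ` in `a ∘ b`. -/
def mulTerm (a b : PseudoDiffOp V) (j : ℤ) (p : ℤ × ℕ) : V :=
  (Ring.choose p.1 p.2 : ℤ) • (a.coeff p.1 * (Differential.deriv)^[p.2] (b.coeff (j - p.1 + p.2)))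

theorem mulTerm_eq_zero {a b : PseudoDiffOp V} {M N : ℤ} (hM : ∀ n, M < n → a.coeff n = 0)
    (hN : ∀ n, N < n → b.coeff n = 0) {j : ℤ} {p : ℤ × ℕ} (h : M < p.1 ∨ N < j - p.1 + p.2) :
    mulTerm a b j p = 0 := by
  rcases h with h | h
  · simp [mulTerm, hM _ h]
  · simp [mulTerm, hN _ h, iterate_map_zero]

/-- Only finitely many terms contribute to each coefficient of a product. -/
theorem mulTerm_support_finite (a b : PseudoDiffOp V) (j : ℤ) :
    (Function.support (mulTerm a b j)).Finite := by
  obtain ⟨M, hM⟩ := a.coeff_bounded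
  obtain ⟨N, hN⟩ := b.coeff_bounded
  refine ((Set.finite_Icc (j - N) M).prod (Set.finite_Iic (N - j + M).toNat)).subset ?_
  intro p hp
  have h : ¬ (M < p.1 ∨ N < j - p.1 + p.2) := fun h => hp (mulTerm_eq_zero hM hN h)
  simp only [Set.mem_prod, Set.mem_Icc, Set.mem_Iic]
  omega

/-- The product of pseudodifferential operators, determined by
`∂ᵐ ∘ f = ∑_{k ≥ 0} binom(m, k) f⁽ᵏ⁾ ∂^(m - k)` for all integers `m`. The sum is finite. -/
instance : Mul (PseudoDiffOp V) where
  mul a b := mk (fun j => ∑ᶠ p : ℤ × ℕ, mulTerm a b j p) <| by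
    obtain ⟨M, hM⟩ := a.coeff_bounded
    obtain ⟨N, hN⟩ := b.coeff_bounded
    refine ⟨M + N, fun j hj => ?_⟩
    rw [← finsum_zero (α := ℤ × ℕ) (M := V)]
    refine finsum_congr fun p => mulTerm_eq_zero hM hN ?_
    omega

theorem coeff_mul (a b : PseudoDiffOp V) (j : ℤ) :
    (a * b).coeff j = ∑ᶠ p : ℤ × ℕ, mulTerm a b j p := rfl

end PseudoDiffOp

/-- The symbol `∂` in the field `F((∂⁻¹))` of pseudodifferential operators with constant
coefficients, which is the field of Laurent series over `F` in the variable `∂⁻¹`. -/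
def constDel (F : Type*) [Field F] : LaurentSeries F := HahnSeries.single (-1 : ℤ) (1 : F)

/-- For a field extension `L` of a differential field `K` with field of constants `F`, the
inclusion `F((∂⁻¹)) → L((∂⁻¹))`. The coefficient of `∂ⁿ` is that of `(∂⁻¹)⁻ⁿ`. -/
def constToPseudoDiffOp (K L : Type*) [Field K] [Differential K] [Field L] [Algebra K L]
    (f : LaurentSeries (constantSubfield K)) : PseudoDiffOp L :=
  PseudoDiffOp.mk (fun n => algebraMap K L (f.coeff (-n) : constantSubfield K))
    ⟨-f.order, fun n hn => by
      rw [HahnSeries.coeff_eq_zero_of_lt_order (by omega)]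
      simp⟩

/-- The matrix pseudodifferential operator `∂ 𝟙₂ + Q`. -/
def delAdd {L : Type*} [CommRing L] (Q : Matrix (Fin 2) (Fin 2) L) :
    Matrix (Fin 2) (Fin 2) (PseudoDiffOp L) :=
  Matrix.diagonal (fun _ => PseudoDiffOp.del) + Q.map PseudoDiffOp.C

/-- A matrix of constant-coefficient operators with trace `0` and determinant `-∂`. -/
def IsConstRoot {F : Type*} [Field F] (Δ : Matrix (Fin 2) (Fin 2) (LaurentSeries F)) : Prop :=
  Δ.trace = 0 ∧ Δ.det = -constDel F

end

/-! The equation `B' + QB = 0` says that `(∂ + Q) B = B ∂` as operators (`delAdd_mul_map_C`), so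
conjugation by `B` carries the square roots of `∂ + Q` to those of `∂`. A square root of `∂`
commutes with its square, so each entry commutes with `∂`, and this forces constant coefficients
(`commute_del_iff`).

What remains is the equation `Δ² = ∂` over the field of Laurent series in `∂⁻¹`. The off-diagonal
entries of `Δ²` are those of `Δ` multiplied by the trace. A nonzero trace would make `Δ` diagonal
and `∂` a square, which its odd order excludes; with trace zero, Cayley–Hamilton gives `Δ² = -det Δ`
(`mul_self_eq_constDel_iff`).

The long part is `PseudoDiffOp.mul_assoc`, without which conjugation is meaningless. It holds for
monomials by binomial identities, and for general operators by truncation. -/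

open Finset.HasAntidiagonal (antidiagonal mem_antidiagonal)

noncomputable section

/-! ### Coefficients, order and bilinearity of the product -/

namespace PseudoDiffOp

section Additive

variable {V : Type*} [CommRing V]

@[simp] theorem coeff_zero (n : ℤ) : (0 : PseudoDiffOp V).coeff n = 0 := rfl

@[simp] theorem coeff_add (a b : PseudoDiffOp V) (n : ℤ) :
    (a + b).coeff n = a.coeff n + b.coeff n := rfl

@[simp] theorem coeff_sub (a b : PseudoDiffOp V) (n : ℤ) :
    (a - b).coeff n = a.coeff n - b.coeff n := rfl

theorem coeff_monomial (m : ℤ) (a : V) (n : ℤ) :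
    (monomial m a).coeff n = if n = m then a else 0 := rfl

@[simp] theorem coeff_monomial_self (m : ℤ) (a : V) : (monomial m a).coeff m = a := if_pos rfl

theorem coeff_monomial_of_ne {m n : ℤ} (h : n ≠ m) (a : V) : (monomial m a).coeff n = 0 :=
  if_neg h

theorem coeff_C (a : V) (n : ℤ) : (C a).coeff n = if n = 0 then a else 0 := rfl

/-- `a` has order at most `N`. -/
def OrderLE (a : PseudoDiffOp V) (N : ℤ) : Prop := ∀ n, N < n → a.coeff n = 0

theorem exists_orderLE (a : PseudoDiffOp V) : ∃ N, a.OrderLE N := a.coeff_bounded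

theorem orderLE_monomial (m : ℤ) (a : V) : (monomial m a).OrderLE m :=
  fun _ hn => coeff_monomial_of_ne hn.ne' a

/-- The finite sums of monomials. -/
def finiteOps (V : Type*) [CommRing V] : AddSubgroup (PseudoDiffOp V) :=
  AddSubgroup.closure (Set.range fun p : ℤ × V => monomial p.1 p.2)

theorem monomial_mem_finiteOps (m : ℤ) (a : V) : monomial m a ∈ finiteOps V :=
  AddSubgroup.subset_closure ⟨(m, a), rfl⟩

/-- The map taking an operator to its coefficient of `∂ⁿ`. -/
def coeffHom (n : ℤ) : PseudoDiffOp V →+ V where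
  toFun a := a.coeff n
  map_zero' := rfl
  map_add' _ _ := rfl

theorem exists_finite_truncation (a : PseudoDiffOp V) (r : ℤ) :
    ∃ s ∈ finiteOps V, (a - s).OrderLE r := by
  obtain ⟨M, hM⟩ := a.exists_orderLE
  refine ⟨∑ n ∈ Finset.Ioc r M, monomial n (a.coeff n),
    sum_mem fun n _ => monomial_mem_finiteOps _ _, fun j hj => ?_⟩
  have h : (∑ n ∈ Finset.Ioc r M, monomial n (a.coeff n)).coeff j =
      ∑ n ∈ Finset.Ioc r M, if j = n then a.coeff n else 0 :=
    map_sum (coeffHom j) _ _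
  rw [coeff_sub, h, Finset.sum_ite_eq]
  split_ifs with hjM
  · exact sub_self _
  · rw [hM j (by simpa [hj] using hjM), sub_zero]

theorem OrderLE.of_sub {a s : PseudoDiffOp V} {N r : ℤ} (ha : a.OrderLE N)
    (h : (a - s).OrderLE r) (hr : r ≤ N) : s.OrderLE N := fun n hn => by
  have := h n (by omega)
  rw [coeff_sub, ha n hn, zero_sub, neg_eq_zero] at this
  exact this

end Additive

variable {V : Type*} [CommRing V] [Differential V]

theorem OrderLE.mul {a b : PseudoDiffOp V} {M N : ℤ} (ha : a.OrderLE M) (hb : b.OrderLE N) :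
    (a * b).OrderLE (M + N) := fun j hj => by
  rw [coeff_mul]
  refine (finsum_congr fun p => mulTerm_eq_zero ha hb ?_).trans finsum_zero
  omega

protected theorem add_mul (a b c : PseudoDiffOp V) : (a + b) * c = a * c + b * c := by
  ext j
  rw [coeff_add, coeff_mul, coeff_mul, coeff_mul,
    ← finsum_add_distrib (mulTerm_support_finite a c j) (mulTerm_support_finite b c j)]
  exact finsum_congr fun p => by simp [mulTerm, add_mul]

protected theorem mul_add (a b c : PseudoDiffOp V) : a * (b + c) = a * b + a * c := by
  ext j
  rw [coeff_add, coeff_mul, coeff_mul, coeff_mul,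
    ← finsum_add_distrib (mulTerm_support_finite a b j) (mulTerm_support_finite a c j)]
  exact finsum_congr fun p => by simp [mulTerm, iterate_map_add, mul_add]

scoped instance : NonUnitalNonAssocRing (PseudoDiffOp V) where
  left_distrib := PseudoDiffOp.mul_add
  right_distrib := PseudoDiffOp.add_mul
  zero_mul a := by
    have h := PseudoDiffOp.add_mul 0 0 a
    rwa [add_zero, left_eq_add] at h
  mul_zero a := by
    have h := PseudoDiffOp.mul_add a 0 0
    rwa [add_zero, left_eq_add] at h

/-- Coefficients are counted downwards from the top degree `l + N`: a drop of `T` splits into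
derivatives taken and descent within `y`. -/
theorem coeff_monomial_mul (l : ℤ) (a : V) {y : PseudoDiffOp V} {N : ℤ} (hy : y.OrderLE N)
    (T : ℕ) : (monomial l a * y).coeff (l + N - T) = ∑ p ∈ antidiagonal T,
      (Ring.choose l p.1 : ℤ) • (a * Differential.deriv^[p.1] (y.coeff (N - p.2))) := by
  classical
  rw [coeff_mul, finsum_eq_finsetSum_of_support_subset
    (s := (antidiagonal T).image fun p => (l, p.1)), Finset.sum_image]
  · refine Finset.sum_congr rfl fun p hp => ?_
    rw [mem_antidiagonal] at hp
    have h : l + N - (T : ℤ) - l + p.1 = N - p.2 := by omega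
    rw [mulTerm, coeff_monomial_self, h]
  · intro p hp q hq h
    rw [Finset.mem_coe, mem_antidiagonal] at hp hq
    simp only [Prod.mk.injEq, true_and] at h
    ext <;> omega
  · rintro ⟨m, k⟩ hp
    by_contra hmem
    refine hp ?_
    by_cases hm : m = l
    · refine mulTerm_eq_zero (orderLE_monomial l a) hy (Or.inr ?_)
      by_contra hk
      refine hmem ?_
      simp only [Finset.coe_image, Set.mem_image, Finset.mem_coe, mem_antidiagonal]
      refine ⟨(k, T - k), ?_, by simp [hm]⟩
      simp only [hm] at hk
      omega
    · simp [mulTerm, coeff_monomial_of_ne hm]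

theorem coeff_mul_monomial {x : PseudoDiffOp V} {M : ℤ} (hx : x.OrderLE M) (n : ℤ) (c : V)
    (T : ℕ) : (x * monomial n c).coeff (M + n - T) = ∑ p ∈ antidiagonal T,
      (Ring.choose (M - p.1) p.2 : ℤ) • (x.coeff (M - p.1) * Differential.deriv^[p.2] c) := by
  classical
  rw [coeff_mul, finsum_eq_finsetSum_of_support_subset
    (s := (antidiagonal T).image fun p => (M - (p.1 : ℤ), p.2)), Finset.sum_image]
  · refine Finset.sum_congr rfl fun p hp => ?_
    rw [mem_antidiagonal] at hp
    have h : M + n - (T : ℤ) - (M - p.1) + p.2 = n := by omega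
    rw [mulTerm, h, coeff_monomial_self]
  · intro p hp q hq h
    rw [Finset.mem_coe, mem_antidiagonal] at hp hq
    simp only [Prod.mk.injEq] at h
    ext <;> omega
  · rintro ⟨m, k⟩ hp
    by_contra hmem
    refine hp ?_
    by_cases hm : M < m
    · exact mulTerm_eq_zero hx (orderLE_monomial n c) (Or.inl hm)
    · by_cases hk : M + n - T - m + k = n
      · refine absurd ?_ hmem
        simp only [Finset.coe_image, Set.mem_image, Finset.mem_coe, mem_antidiagonal]
        refine ⟨((M - m).toNat, k), by omega, by ext <;> simp; omega⟩
      · simp [mulTerm, coeff_monomial_of_ne hk, iterate_map_zero]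

theorem coeff_monomial_mul_monomial (m n : ℤ) (a b : V) (k : ℕ) :
    (monomial m a * monomial n b).coeff (m + n - k) =
      (Ring.choose m k : ℤ) • (a * Differential.deriv^[k] b) := by
  rw [coeff_monomial_mul m a (orderLE_monomial n b),
    Finset.sum_eq_single_of_mem (k, 0) (by simp)]
  · simp
  · rintro ⟨i, j⟩ hp hne
    have hj : j ≠ 0 := by
      rintro rfl
      exact hne (by simpa using hp)
    rw [coeff_monomial_of_ne (by simpa using hj)]
    simp [iterate_map_zero]

end PseudoDiffOp

/-! ### Associativity -/

theorem Differential.iterate_deriv_mul {V : Type*} [CommRing V] [Differential V] (a b : V)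
    (n : ℕ) : Differential.deriv^[n] (a * b) = ∑ p ∈ antidiagonal n,
      n.choose p.1 • (Differential.deriv^[p.1] a * Differential.deriv^[p.2] b) := by
  induction n with
  | zero => simp
  | succ n ih =>
    rw [Finset.sum_antidiagonal_choose_succ_nsmul
        (fun i j => Differential.deriv^[i] a * Differential.deriv^[j] b) n,
      Function.iterate_succ_apply', ih, map_sum, ← Finset.sum_add_distrib]
    refine Finset.sum_congr rfl fun p hp => ?_
    have hs : n.choose p.2 = n.choose p.1 := by
      rw [mem_antidiagonal] at hp
      rw [← hp, Nat.choose_symm_add]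
    rw [map_nsmul, Derivation.leibniz, hs, Function.iterate_succ_apply',
      Function.iterate_succ_apply', smul_add, smul_eq_mul, smul_eq_mul,
      mul_comm (Differential.deriv^[p.2] b)]

theorem sum_antidiagonal_antidiagonal_assoc {M : Type*} [AddCommMonoid M]
    (f : ℕ → ℕ → ℕ → M) (n : ℕ) :
    ∑ p ∈ antidiagonal n, ∑ q ∈ antidiagonal p.1, f q.1 q.2 p.2 =
      ∑ p ∈ antidiagonal n, ∑ q ∈ antidiagonal p.2, f p.1 q.1 q.2 := by
  rw [Finset.sum_sigma', Finset.sum_sigma']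
  refine Finset.sum_nbij' (fun x => ⟨(x.2.1, x.2.2 + x.1.2), (x.2.2, x.1.2)⟩)
    (fun x => ⟨(x.1.1 + x.2.1, x.2.2), (x.1.1, x.2.1)⟩) ?_ ?_ ?_ ?_ ?_ <;>
  · rintro ⟨⟨a, b⟩, c, d⟩ h
    simp only [Finset.mem_sigma, mem_antidiagonal] at h
    obtain ⟨h₁, rfl⟩ := h
    first
    | rfl
    | exact Finset.mem_sigma.2 ⟨mem_antidiagonal.2 (by dsimp only; omega),
        mem_antidiagonal.2 (by dsimp only)⟩

namespace PseudoDiffOp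

variable {V : Type*} [CommRing V] [Differential V]

/-- Both sides expand into one sum over `i + t + k = T`. On the left Vandermonde splits `choose (l +
m - i)` as `(l - i) + m`; on the right the Leibniz rule meets `choose l s * choose s i = choose l i
* choose (l - i) (s - i)`. -/
theorem monomial_mul_assoc (l m n : ℤ) (a b c : V) :
    monomial l a * monomial m b * monomial n c = monomial l a * (monomial m b * monomial n c) := by
  ext j
  have h₁ := (orderLE_monomial l a).mul (orderLE_monomial m b)
  have h₂ := (orderLE_monomial m b).mul (orderLE_monomial n c)
  rcases lt_or_ge (l + m + n) j with hj | hj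
  · rw [h₁.mul (orderLE_monomial n c) j hj, (orderLE_monomial l a).mul h₂ j (by omega)]
  obtain ⟨T, rfl⟩ : ∃ T : ℕ, j = l + m + n - T := ⟨(l + m + n - j).toNat, by omega⟩
  rw [coeff_mul_monomial h₁, add_assoc, coeff_monomial_mul l a h₂]
  simp only [coeff_monomial_mul_monomial]
  have hL : ∀ p : ℕ × ℕ, (Ring.choose (l + m - p.1) p.2 : ℤ) •
      ((Ring.choose l p.1 : ℤ) • (a * Differential.deriv^[p.1] b) * Differential.deriv^[p.2] c) =
      ∑ q ∈ antidiagonal p.2, (Ring.choose l p.1 * Ring.choose (l - p.1) q.1 *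
        Ring.choose m q.2 : ℤ) •
        (a * (Differential.deriv^[p.1] b * Differential.deriv^[q.1 + q.2] c)) := fun p => by
    have h : ∀ q ∈ antidiagonal p.2, (Ring.choose l p.1 * Ring.choose (l - p.1) q.1 *
        Ring.choose m q.2 : ℤ) •
        (a * (Differential.deriv^[p.1] b * Differential.deriv^[q.1 + q.2] c)) =
        (Ring.choose l p.1 * (Ring.choose (l - p.1) q.1 * Ring.choose m q.2) : ℤ) •
        (a * (Differential.deriv^[p.1] b * Differential.deriv^[p.2] c)) := fun q hq => by
      rw [mem_antidiagonal.1 hq, mul_assoc]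
    rw [Finset.sum_congr rfl h, ← Finset.sum_smul, ← Finset.mul_sum,
      ← Ring.add_choose_eq _ (Commute.all _ _), smul_mul_assoc, smul_smul, mul_assoc a,
      mul_comm (Ring.choose l p.1)]
    congr 3
    ring
  have hR : ∀ p : ℕ × ℕ, (Ring.choose l p.1 : ℤ) • (a * Differential.deriv^[p.1]
      ((Ring.choose m p.2 : ℤ) • (b * Differential.deriv^[p.2] c))) =
      ∑ q ∈ antidiagonal p.1, (Ring.choose l q.1 * Ring.choose (l - q.1) q.2 *
        Ring.choose m p.2 : ℤ) •
        (a * (Differential.deriv^[q.1] b * Differential.deriv^[q.2 + p.2] c)) := fun p => by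
    rw [iterate_map_zsmul, Differential.iterate_deriv_mul, Finset.smul_sum, Finset.mul_sum,
      Finset.smul_sum]
    refine Finset.sum_congr rfl fun q hq => ?_
    rw [mem_antidiagonal] at hq
    have h := Ring.choose_smul_choose l (n := p.1) (k := q.1) (by omega)
    rw [show p.1 - q.1 = q.2 by omega, nsmul_eq_mul] at h
    rw [← h, ← natCast_zsmul, smul_smul, mul_smul_comm, smul_smul, Function.iterate_add_apply]
    congr 1
    ring
  rw [Finset.sum_congr rfl fun p _ => hL p, Finset.sum_congr rfl fun p _ => hR p]
  exact (sum_antidiagonal_antidiagonal_assoc (fun i t k => (Ring.choose l i *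
    Ring.choose (l - i) t * Ring.choose m k : ℤ) •
    (a * (Differential.deriv^[i] b * Differential.deriv^[t + k] c))) T).symm

theorem coeff_mul_assoc_congr {a b c a' b' c' : PseudoDiffOp V} (j : ℤ)
    (h : a' * b' * c' = a' * (b' * c')) (h₁ : (a * b * c - a' * b' * c').coeff j = 0)
    (h₂ : (a * (b * c) - a' * (b' * c')).coeff j = 0) :
    (a * b * c).coeff j = (a * (b * c)).coeff j := by
  rw [coeff_sub, sub_eq_zero] at h₁ h₂
  rw [h₁, h₂, h]

theorem mul_assoc_of_mem_finiteOps {a b c : PseudoDiffOp V} (ha : a ∈ finiteOps V)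
    (hb : b ∈ finiteOps V) (hc : c ∈ finiteOps V) : a * b * c = a * (b * c) := by
  induction ha using AddSubgroup.closure_induction with
  | zero => simp
  | add x y _ _ hx hy => simp [add_mul, hx, hy]
  | neg x _ hx => simp [neg_mul, hx]
  | mem a ha =>
    induction hb using AddSubgroup.closure_induction with
    | zero => simp
    | add x y _ _ hx hy => simp [add_mul, mul_add, hx, hy]
    | neg x _ hx => simp [hx]
    | mem b hb =>
      induction hc using AddSubgroup.closure_induction with
      | zero => simp
      | add x y _ _ hx hy => simp [mul_add, hx, hy]
      | neg x _ hx => simp [hx]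
      | mem c hc =>
        obtain ⟨p, rfl⟩ := ha
        obtain ⟨q, rfl⟩ := hb
        obtain ⟨r, rfl⟩ := hc
        exact monomial_mul_assoc _ _ _ _ _ _

protected theorem mul_assoc (a b c : PseudoDiffOp V) : a * b * c = a * (b * c) := by
  ext j
  obtain ⟨M, ha⟩ := a.exists_orderLE
  obtain ⟨N, hb⟩ := b.exists_orderLE
  obtain ⟨P, hc⟩ := c.exists_orderLE
  -- Each error, multiplied by the other two factors, has order at most `j - 1` and so misses the
  -- coefficient of `∂ʲ`. The `min` keeps the truncations within the original order bounds.
  obtain ⟨a', ha', hra⟩ := a.exists_finite_truncation (min M (j - N - P - 1))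
  obtain ⟨b', hb', hrb⟩ := b.exists_finite_truncation (min N (j - M - P - 1))
  obtain ⟨c', hc', hrc⟩ := c.exists_finite_truncation (min P (j - M - N - 1))
  have hMa := ha.of_sub hra (min_le_left _ _)
  have hNb := hb.of_sub hrb (min_le_left _ _)
  refine coeff_mul_assoc_congr j (mul_assoc_of_mem_finiteOps ha' hb' hc') ?_ ?_
  · have h : a * b * c - a' * b' * c' =
        (a - a') * b * c + a' * (b - b') * c + a' * b' * (c - c') := by
      simp only [sub_mul, mul_sub]
      abel
    rw [h, coeff_add, coeff_add, (hra.mul hb).mul hc j (by omega),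
      (hMa.mul hrb).mul hc j (by omega), (hMa.mul hNb).mul hrc j (by omega)]
    simp
  · have h : a * (b * c) - a' * (b' * c') =
        (a - a') * (b * c) + a' * ((b - b') * c) + a' * (b' * (c - c')) := by
      simp only [sub_mul, mul_sub]
      abel
    rw [h, coeff_add, coeff_add, hra.mul (hb.mul hc) j (by omega),
      hMa.mul (hrb.mul hc) j (by omega), hMa.mul (hNb.mul hrc) j (by omega)]
    simp

theorem coeff_C_mul (a : V) (y : PseudoDiffOp V) (j : ℤ) : (C a * y).coeff j = a * y.coeff j := by
  rw [coeff_mul, finsum_eq_single _ ((0 : ℤ), 0)]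
  · simp [mulTerm, C]
  · rintro ⟨m, k⟩ hne
    by_cases hm : m = 0
    · have hk : k ≠ 0 := by
        rintro rfl
        exact hne (by rw [hm])
      simp [mulTerm, hm, Ring.choose_zero_pos ℤ (Nat.pos_of_ne_zero hk)]
    · simp [mulTerm, C, coeff_monomial_of_ne hm]

theorem coeff_mul_monomial_one (x : PseudoDiffOp V) (n j : ℤ) :
    (x * monomial n 1).coeff j = x.coeff (j - n) := by
  rw [coeff_mul, finsum_eq_single _ (j - n, 0)]
  · simp [mulTerm]
  · rintro ⟨m, k⟩ hne
    rcases k with - | k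
    · have hm : m ≠ j - n := fun h => hne (by rw [h])
      rw [mulTerm, coeff_monomial_of_ne (by simp; omega)]
      simp
    · have h : ∀ i, Differential.deriv^[k + 1] ((monomial n (1 : V)).coeff i) = 0 := fun i => by
        rw [coeff_monomial, Function.iterate_succ_apply]
        split_ifs <;> simp [iterate_map_zero]
      rw [mulTerm, h, mul_zero, smul_zero]

scoped instance : Ring (PseudoDiffOp V) where
  __ : NonUnitalNonAssocRing (PseudoDiffOp V) := inferInstance
  mul_assoc := PseudoDiffOp.mul_assoc
  one := C 1
  one_mul a := by
    ext j
    exact (coeff_C_mul 1 a j).trans (one_mul _)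
  mul_one a := by
    ext j
    exact (coeff_mul_monomial_one a 0 j).trans (by rw [sub_zero])

end PseudoDiffOp

/-! ### Commutation with `∂` -/

namespace PseudoDiffOp

variable {V : Type*} [CommRing V] [Differential V]

theorem coeff_mul_del (y : PseudoDiffOp V) (j : ℤ) : (y * del).coeff j = y.coeff (j - 1) :=
  coeff_mul_monomial_one y 1 j

theorem coeff_del_mul (y : PseudoDiffOp V) (j : ℤ) :
    (del * y).coeff j = y.coeff (j - 1) + (y.coeff j)′ := by
  classical
  rw [coeff_mul, finsum_eq_finsetSum_of_support_subset
    (s := {((1 : ℤ), 0), ((1 : ℤ), 1)}), Finset.sum_pair (by simp)]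
  · simp [mulTerm, del]
  · rintro ⟨m, k⟩ hp
    by_contra hne
    refine hp ?_
    by_cases hm : m = 1
    · have hk : 1 < k := by
        simp only [hm, Finset.coe_insert, Finset.coe_singleton, Set.mem_insert_iff, Prod.mk.injEq,
          true_and, Set.mem_singleton_iff] at hne
        omega
      have h : Ring.choose (1 : ℤ) k = 0 := by
        have := Ring.choose_natCast (R := ℤ) 1 k
        rwa [Nat.choose_eq_zero_of_lt hk, Nat.cast_one, Nat.cast_zero] at this
      simp [mulTerm, hm, h]
    · simp [mulTerm, del, coeff_monomial_of_ne hm]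

/-- The commutator with `∂` differentiates every coefficient. -/
theorem commute_del_iff {y : PseudoDiffOp V} : Commute del y ↔ ∀ j, (y.coeff j)′ = 0 := by
  rw [commute_iff_eq, PseudoDiffOp.ext_iff]
  simp only [coeff_del_mul, coeff_mul_del, add_eq_left]

/-- The embedding of the functions as the operators of order zero. -/
def CHom (V : Type*) [CommRing V] [Differential V] : V →+* PseudoDiffOp V where
  toFun := C
  map_one' := rfl
  map_mul' a b := by
    ext j
    rw [coeff_C_mul, coeff_C, coeff_C, mul_ite, mul_zero]
  map_zero' := by
    ext j
    simp [coeff_C]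
  map_add' a b := by
    ext j
    rw [coeff_add, coeff_C, coeff_C, coeff_C]
    split_ifs <;> simp

theorem del_mul_C (a : V) : del * C a = C a * del + C a′ := by
  ext j
  rw [coeff_del_mul, coeff_add, coeff_mul_del, coeff_C, coeff_C, coeff_C]
  split_ifs <;> simp

end PseudoDiffOp

open PseudoDiffOp

/-! ### Embedding of the constant-coefficient operators -/

section ConstantCoefficients

variable (K L : Type*) [Field K] [Differential K] [Field L] [Algebra K L]

theorem coeff_constToPseudoDiffOp (f : LaurentSeries (constantSubfield K)) (n : ℤ) :
    (constToPseudoDiffOp K L f).coeff n =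
      algebraMap K L (f.coeff (-n) : constantSubfield K) := rfl

theorem constToPseudoDiffOp_single (n : ℤ) (a : constantSubfield K) :
    constToPseudoDiffOp K L (HahnSeries.single n a) = monomial (-n) (algebraMap K L a) := by
  ext j
  rw [coeff_constToPseudoDiffOp, coeff_monomial, HahnSeries.coeff_single]
  by_cases h : j = -n
  · simp [h]
  · have h' : -j ≠ n := by omega
    simp [h, h']

theorem constToPseudoDiffOp_injective : Function.Injective (constToPseudoDiffOp K L) :=
  fun f g h => by
    ext n
    have := congrArg (fun x => x.coeff (-n)) h
    simpa [coeff_constToPseudoDiffOp] using this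

variable [Differential L] [DifferentialAlgebra K L]

theorem deriv_algebraMap_constant (a : constantSubfield K) : (algebraMap K L a)′ = 0 := by
  rw [deriv_algebraMap, show (a : K)′ = 0 from a.2, map_zero]

theorem mem_range_constToPseudoDiffOp [Differential.ContainConstants K L] {y : PseudoDiffOp L}
    (hy : ∀ j, (y.coeff j)′ = 0) : y ∈ Set.range (constToPseudoDiffOp K L) := by
  have hex : ∀ n, ∃ a : constantSubfield K, algebraMap K L a = y.coeff (-n) := fun n => by
    obtain ⟨a, ha⟩ := mem_range_of_deriv_eq_zero K (hy (-n))
    refine ⟨⟨a, ?_⟩, ha⟩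
    -- A preimage in `K` of a constant is itself constant, since `algebraMap` commutes with the
    -- derivation and is injective.
    have h := hy (-n)
    rw [← ha, deriv_algebraMap] at h
    exact (map_eq_zero _).1 h
  choose f hf using hex
  obtain ⟨N, hN⟩ := y.exists_orderLE
  have hbd : BddBelow (Function.support f) :=
    ⟨-N, fun m hm => le_of_not_gt fun hlt => hm <| by
      have h := hf m
      rw [hN _ (by omega), map_eq_zero] at h
      exact_mod_cast h⟩
  refine ⟨HahnSeries.ofSuppBddBelow f hbd, ?_⟩
  ext n
  rw [coeff_constToPseudoDiffOp, HahnSeries.coeff_ofSuppBddBelow, hf, neg_neg]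

/-- The embedding of the constant-coefficient operators over `K` into the pseudodifferential
operators over `L`. -/
def constHom : LaurentSeries (constantSubfield K) →+* PseudoDiffOp L where
  toFun := constToPseudoDiffOp K L
  map_one' := (constToPseudoDiffOp_single K L 0 1).trans (by
    rw [neg_zero, OneMemClass.coe_one, map_one]; rfl)
  map_zero' := by
    ext n
    simp [coeff_constToPseudoDiffOp]
  map_add' f g := by
    ext n
    simp [coeff_constToPseudoDiffOp]
  map_mul' f g := by
    classical
    ext n
    -- Terms with `k ≥ 1` differentiate a constant; the terms with `k = 0` form the Laurent
    -- convolution.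
    rw [coeff_constToPseudoDiffOp, HahnSeries.coeff_mul, coeff_mul,
      finsum_eq_finsetSum_of_support_subset
        (s := (Finset.antidiagonal f.isPWO_support g.isPWO_support (-n)).image
          fun p => (-p.1, 0)), Finset.sum_image]
    · rw [AddSubmonoidClass.coe_finsetSum, map_sum]
      refine Finset.sum_congr rfl fun p hp => ?_
      obtain ⟨-, -, h⟩ := Finset.mem_antidiagonal.1 hp
      have h' : -(n + p.1) = p.2 := by omega
      simp [mulTerm, coeff_constToPseudoDiffOp, h']
    · intro p hp q hq h
      obtain ⟨-, -, hp⟩ := Finset.mem_antidiagonal.1 (Finset.mem_coe.1 hp)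
      obtain ⟨-, -, hq⟩ := Finset.mem_antidiagonal.1 (Finset.mem_coe.1 hq)
      simp only [Prod.mk.injEq, and_true] at h
      ext <;> omega
    · rintro ⟨m, k⟩ hp
      rcases k with - | k
      · simp only [Function.mem_support, mulTerm, coeff_constToPseudoDiffOp, Ring.choose_zero_right,
          one_smul, Function.iterate_zero_apply, mul_ne_zero_iff, ne_eq, map_eq_zero,
          ZeroMemClass.coe_eq_zero] at hp
        simp only [Finset.coe_image, Set.mem_image, Finset.mem_coe, Finset.mem_antidiagonal]
        refine ⟨(-m, m - n), ⟨hp.1, ?_, by ring⟩, by simp⟩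
        have h : -(n - m + ((0 : ℕ) : ℤ)) = m - n := by push_cast; ring
        exact h ▸ hp.2
      · refine absurd ?_ hp
        rw [mulTerm, Function.iterate_succ_apply, coeff_constToPseudoDiffOp,
          coeff_constToPseudoDiffOp, deriv_algebraMap_constant, iterate_map_zero, mul_zero,
          smul_zero]

theorem constHom_constDel : constHom K L (constDel (constantSubfield K)) = del :=
  (constToPseudoDiffOp_single K L (-1) 1).trans (by
    rw [neg_neg, OneMemClass.coe_one, map_one]; rfl)

end ConstantCoefficients

/-! ### Square roots of `∂` over a commutative field -/

theorem not_isSquare_constDel (F : Type*) [Field F] (d : LaurentSeries F) :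
    d ^ 2 ≠ constDel F := fun h => by
  -- The order of `d ^ 2` is even (zero when `d = 0`), while `∂` has order `-1`.
  have h' := congrArg HahnSeries.order h
  rw [HahnSeries.order_pow, constDel, HahnSeries.order_single one_ne_zero, nsmul_eq_mul] at h'
  omega

theorem mul_self_eq_constDel_iff {F : Type*} [Field F]
    (Δ : Matrix (Fin 2) (Fin 2) (LaurentSeries F)) :
    Δ * Δ = Matrix.diagonal (fun _ => constDel F) ↔ IsConstRoot Δ := by
  rw [IsConstRoot, Matrix.trace_fin_two, Matrix.det_fin_two, ← Matrix.ext_iff]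
  simp only [Fin.forall_fin_two, Matrix.mul_apply, Fin.sum_univ_two, Matrix.diagonal_apply,
    if_pos, zero_ne_one, one_ne_zero, ite_false]
  constructor
  · rintro ⟨⟨h₀₀, h₀₁⟩, h₁₀, h₁₁⟩
    have ht : Δ 0 0 + Δ 1 1 = 0 := by
      by_contra ht
      have hβ : Δ 0 1 = 0 := (mul_eq_zero.1 (show (Δ 0 0 + Δ 1 1) * Δ 0 1 = 0 by
        linear_combination h₀₁)).resolve_left ht
      refine not_isSquare_constDel F (Δ 0 0) ?_
      rw [hβ] at h₀₀
      linear_combination h₀₀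
    exact ⟨ht, by linear_combination Δ 0 0 * ht - h₀₀⟩
  · rintro ⟨ht, hd⟩
    refine ⟨⟨?_, ?_⟩, ?_, ?_⟩
    · linear_combination Δ 0 0 * ht - hd
    · linear_combination Δ 0 1 * ht
    · linear_combination Δ 1 0 * ht
    · linear_combination Δ 1 1 * ht - hd

theorem isConstRoot_iff_exists {F : Type*} [Field F]
    (Δ : Matrix (Fin 2) (Fin 2) (LaurentSeries F)) :
    IsConstRoot Δ ↔ ∃ α β : LaurentSeries F, β ≠ 0 ∧
      Δ = !![α, β; β⁻¹ * (constDel F - α ^ 2), -α] := by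
  constructor
  · rintro ⟨ht, hd⟩
    rw [Matrix.trace_fin_two] at ht
    rw [Matrix.det_fin_two] at hd
    -- With `β = 0`, trace and determinant would give `α² = ∂`.
    have hβ : Δ 0 1 ≠ 0 := fun hβ => by
      refine not_isSquare_constDel F (Δ 0 0) ?_
      rw [hβ] at hd
      linear_combination Δ 0 0 * ht - hd
    refine ⟨Δ 0 0, Δ 0 1, hβ, ?_⟩
    have h₁₀ : Δ 1 0 = (Δ 0 1)⁻¹ * (constDel F - Δ 0 0 ^ 2) := by
      rw [eq_inv_mul_iff_mul_eq₀ hβ]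
      linear_combination Δ 0 0 * ht - hd
    rw [← h₁₀, ← eq_neg_of_add_eq_zero_right ht]
    exact Matrix.eta_fin_two Δ
  · rintro ⟨α, β, hβ, rfl⟩
    refine ⟨by simp [Matrix.trace_fin_two], ?_⟩
    rw [Matrix.det_fin_two_of, mul_inv_cancel_left₀ hβ]
    ring

/-! ### Reduction to constant coefficients and conjugation -/

section SquareRoots

variable {K L : Type*} [Field K] [Differential K] [Field L] [Differential L] [Algebra K L]
  [DifferentialAlgebra K L]

theorem mul_self_eq_del_iff [Differential.ContainConstants K L]
    (S : Matrix (Fin 2) (Fin 2) (PseudoDiffOp L)) :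
    S * S = Matrix.diagonal (fun _ => del) ↔
      ∃ Δ : Matrix (Fin 2) (Fin 2) (LaurentSeries (constantSubfield K)),
        IsConstRoot Δ ∧ S = Δ.map (constToPseudoDiffOp K L) := by
  have hdel : (constHom K L).mapMatrix
      (Matrix.diagonal (fun _ : Fin 2 => constDel (constantSubfield K))) =
      Matrix.diagonal (fun _ => del) := by
    rw [RingHom.mapMatrix_apply, Matrix.diagonal_map (map_zero _), constHom_constDel]
  constructor
  · intro hS
    -- `S` commutes with its own square.
    have hcomm : Matrix.diagonal (fun _ => del) * S = S * Matrix.diagonal (fun _ => del) := by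
      rw [← hS, mul_assoc]
    have hmem : ∀ i j, S i j ∈ Set.range (constToPseudoDiffOp K L) := fun i j =>
      mem_range_constToPseudoDiffOp K L <| commute_del_iff.1 <| by
        have := congrFun (congrFun hcomm i) j
        rwa [Matrix.diagonal_mul, Matrix.mul_diagonal] at this
    choose Δ hΔ using hmem
    have hSΔ : S = (constHom K L).mapMatrix (Matrix.of Δ) := by
      ext1 i j
      exact (hΔ i j).symm
    refine ⟨Matrix.of Δ, (mul_self_eq_constDel_iff _).1 ?_, hSΔ⟩
    refine Matrix.map_injective (constToPseudoDiffOp_injective K L) ?_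
    change (constHom K L).mapMatrix _ = (constHom K L).mapMatrix _
    rw [map_mul, ← hSΔ, hdel, hS]
  · rintro ⟨Δ, hΔ, rfl⟩
    change (constHom K L).mapMatrix Δ * (constHom K L).mapMatrix Δ = _
    rw [← map_mul, (mul_self_eq_constDel_iff Δ).2 hΔ, hdel]

/-- Moving `∂` past `B` leaves `B'`, which cancels against `QB`. -/
theorem delAdd_mul_map_C (Q B : Matrix (Fin 2) (Fin 2) L)
    (h : B.map (fun b => b′) + Q * B = 0) :
    delAdd Q * B.map C = B.map C * Matrix.diagonal (fun _ => del) := by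
  have hmap : (B.map fun b => C b′) + Q.map C * B.map C = 0 := by
    have := congrArg (CHom L).mapMatrix h
    rwa [map_add, map_mul, map_zero, RingHom.mapMatrix_apply, Matrix.map_map] at this
  have hdel : Matrix.diagonal (fun _ : Fin 2 => del) * B.map C =
      B.map C * Matrix.diagonal (fun _ => del) + B.map fun b => C b′ := by
    ext1 i j
    rw [Matrix.diagonal_mul, Matrix.add_apply, Matrix.mul_diagonal]
    exact del_mul_C _
  rw [delAdd, add_mul, hdel, add_assoc, hmap, add_zero]

theorem mul_self_eq_delAdd_iff [Differential.ContainConstants K L]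
    (Q B : Matrix (Fin 2) (Fin 2) L) (hB : IsUnit B) (h : B.map (fun b => b′) + Q * B = 0)
    (R : Matrix (Fin 2) (Fin 2) (PseudoDiffOp L)) :
    R * R = delAdd Q ↔
      ∃ Δ : Matrix (Fin 2) (Fin 2) (LaurentSeries (constantSubfield K)),
        IsConstRoot Δ ∧
        R = B.map C * Δ.map (constToPseudoDiffOp K L) * B⁻¹.map C := by
  have hdet := (Matrix.isUnit_iff_isUnit_det B).1 hB
  let u : (Matrix (Fin 2) (Fin 2) (PseudoDiffOp L))ˣ :=
    ⟨B.map C, B⁻¹.map C, by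
      change (CHom L).mapMatrix B * (CHom L).mapMatrix B⁻¹ = 1
      rw [← map_mul, Matrix.mul_nonsing_inv B hdet, map_one], by
      change (CHom L).mapMatrix B⁻¹ * (CHom L).mapMatrix B = 1
      rw [← map_mul, Matrix.nonsing_inv_mul B hdet, map_one]⟩
  have hQ : delAdd Q = u.val * Matrix.diagonal (fun _ => del) * u⁻¹.val :=
    (Units.eq_mul_inv_iff_mul_eq u).2 (delAdd_mul_map_C Q B h)
  have hR : R * R = delAdd Q ↔ (u⁻¹.val * R * u.val) * (u⁻¹.val * R * u.val) =
      Matrix.diagonal (fun _ => del) := by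
    rw [hQ, Units.eq_mul_inv_iff_mul_eq, ← Units.inv_mul_eq_iff_eq_mul]
    simp only [mul_assoc, Units.mul_inv_cancel_left]
  rw [hR, mul_self_eq_del_iff (K := K)]
  refine exists_congr fun Δ => and_congr_right fun _ => ?_
  change _ ↔ R = u.val * _ * u⁻¹.val
  rw [Units.eq_mul_inv_iff_mul_eq, mul_assoc, Units.inv_mul_eq_iff_eq_mul]

end SquareRoots

end

theorem propositionA3 {K L : Type*} [Field K] [CharZero K] [Differential K]
    [Field L] [Differential L] [Algebra K L] [DifferentialAlgebra K L]
    (Q : Matrix (Fin 2) (Fin 2) K) (B : Matrix (Fin 2) (Fin 2) L) (hB : IsUnit B)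
    (hBQ : B.map (fun b => b′) + Q.map (algebraMap K L) * B = 0) :
    (∀ R : Matrix (Fin 2) (Fin 2) (PseudoDiffOp L),
      R * R = delAdd (Q.map (algebraMap K L)) ↔
        ∃ Δ : Matrix (Fin 2) (Fin 2) (LaurentSeries (constantSubfield L)),
          IsConstRoot Δ ∧
          R = B.map PseudoDiffOp.C * Δ.map (constToPseudoDiffOp L L) *
            B⁻¹.map PseudoDiffOp.C) ∧
    (∀ S : Matrix (Fin 2) (Fin 2) (PseudoDiffOp L),
      S * S = Matrix.diagonal (fun _ => PseudoDiffOp.del) ↔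
        ∃ Δ : Matrix (Fin 2) (Fin 2) (LaurentSeries (constantSubfield L)),
          IsConstRoot Δ ∧ S = Δ.map (constToPseudoDiffOp L L)) ∧
    (∀ Δ : Matrix (Fin 2) (Fin 2) (LaurentSeries (constantSubfield L)),
      IsConstRoot Δ ↔
        ∃ α β : LaurentSeries (constantSubfield L), β ≠ 0 ∧
          Δ = !![α, β; β⁻¹ * (constDel (constantSubfield L) - α ^ 2), -α]) ∧
    (Differential.ContainConstants K L →
      ∀ R : Matrix (Fin 2) (Fin 2) (PseudoDiffOp L),
        R * R = delAdd (Q.map (algebraMap K L)) ↔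
          ∃ Δ : Matrix (Fin 2) (Fin 2) (LaurentSeries (constantSubfield K)),
            IsConstRoot Δ ∧
            R = B.map PseudoDiffOp.C * Δ.map (constToPseudoDiffOp K L) *
              B⁻¹.map PseudoDiffOp.C) := by
  -- The first two claims are the case `K = L`, where the base field trivially contains the
  -- constants.
  refine ⟨mul_self_eq_delAdd_iff _ B hB hBQ, mul_self_eq_del_iff, isConstRoot_iff_exists, ?_⟩
  intro
  exact mul_self_eq_delAdd_iff _ B hB hBQ
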